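/- Let $q:\mathbb R\to\mathbb R$ be locally integrable with $q\ge 0$ almost everywhere, and assume $$\int_{-\infty}^x q(t)\,dt>0\quad\text{and}\quad\int_x^\infty q(t)\,dt>0\qquad\text{for all }x\in\mathbb R$$ (the value $\infty$ is allowed). Let $\mu,\theta:\mathbb R\to(0,\infty)$ be continuous with $$\int_{-\infty}^0\mu(t)\,dt=\int_0^\infty\mu(t)\,dt=\infty,$$ and let $p\in[1,\infty)$. For a positive continuous weight $w$ put $L_{p,w}=\{f\in L_p^{\rm loc}(\mathbb R):\ \|f\|_{p,w}:=\left(\int_{-\infty}^\infty|w(x)f(x)|^p\,dx\right)^{1/p}<\infty\}$. A solution of $-y''+qy=f$ on $\mathbb R$ is a differentiable function $y$ such that $y$ and $y'$ are absolutely continuous on every compact interval and the equation holds almost everywhere. The pair $\{L_{p,\mu},L_{p,\theta}\}$ is called admissible for $-y''+qy=f$ if (I) for every $f\in L_{p,\theta}$ there is a unique solution $y\in L_{p,\mu}$, and (II) there is a constant $c\in(0,\infty)$ such that $\|y\|_{p,\mu}\le c\,\|f\|_{p,\theta}$ for every $f\in L_{p,\theta}$ and the corresponding solution $y\in L_{p,\mu}$.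 Then the equation $z''=qz$ has solutions $u,v$ on $\mathbb R$ such that $u>0$, $v>0$, $u'<0$, $v'>0$, $v'u-u'v=1$ and $|(uv)'|<1$ everywhere on $\mathbb R$, and $\lim_{x\to-\infty}v(x)/u(x)=\lim_{x\to\infty}u(x)/v(x)=0$. Moreover, for every such pair $\{u,v\}$, with the Green function $$G(x,t)=\begin{cases}u(x)v(t),&x\ge t,\\ u(t)v(x),&x\le t,\end{cases}$$ the pair $\{L_{p,\mu},L_{p,\theta}\}$ is admissible for $-y''+qy=f$ if and only if the operator $$(Sf)(x)=\mu(x)\int_{-\infty}^\infty\frac{G(x,t)}{\theta(t)}f(t)\,dt$$ is bounded from $L_p(\mathbb R)$ to $L_p(\mathbb R)$, that is: for every $f\in L_p(\mathbb R)$ the integral converges absolutely for almost every $x$, $Sf\in L_p(\mathbb R)$, and $\|Sf\|_p\le C\|f\|_p$ with a constant $C$ independent of $f$. -/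

import Mathlib

open MeasureTheory Set Filter Topology
open scoped ENNReal NNReal

noncomputable section

namespace SturmLiouville

/-- `f ∈ L_p^loc(ℝ)`. -/
def MemLpLoc (p : ℝ≥0∞) (f : ℝ → ℝ) : Prop :=
  ∀ K : Set ℝ, IsCompact K → MemLp f p (volume.restrict K)

/-- The weighted norm `‖f‖_{p,w} = (∫ |w f|^p)^{1/p}`, with values in `[0, ∞]`. -/
def weightedNorm (p : ℝ≥0∞) (w f : ℝ → ℝ) : ℝ≥0∞ :=
  eLpNorm (fun x => w x * f x) p volume

/-- `f ∈ L_{p,w}`: `f` is in `L_p^loc(ℝ)` and `‖f‖_{p,w} < ∞`. -/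
def MemWeightedLp (p : ℝ≥0∞) (w f : ℝ → ℝ) : Prop :=
  MemLpLoc p f ∧ weightedNorm p w f < ∞

/-- `y` is a solution of `-y'' + q y = f` on `ℝ`: `y` and `y'` are absolutely continuous on every
compact interval, and the equation holds almost everywhere. -/
structure IsSolution (q f y : ℝ → ℝ) : Prop where
  differentiable : Differentiable ℝ y
  ac : ∀ a b : ℝ, AbsolutelyContinuousOnInterval y a b
  ac_deriv : ∀ a b : ℝ, AbsolutelyContinuousOnInterval (deriv y) a b
  eq_ae : ∀ᵐ x : ℝ, -deriv (deriv y) x + q x * y x = f x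

/-- The pair `{L_{p,μ}, L_{p,θ}}` is admissible for `-y'' + q y = f`. -/
def Admissible (p : ℝ≥0∞) (q μ θ : ℝ → ℝ) : Prop :=
  (∀ f : ℝ → ℝ, MemWeightedLp p θ f →
    ∃! y : ℝ → ℝ, IsSolution q f y ∧ MemWeightedLp p μ y) ∧
  ∃ c : ℝ≥0, 0 < c ∧ ∀ f : ℝ → ℝ, MemWeightedLp p θ f →
    ∀ y : ℝ → ℝ, IsSolution q f y → MemWeightedLp p μ y →
      weightedNorm p μ y ≤ c * weightedNorm p θ f

/-- `{u, v}` is a fundamental system of solutions of `z'' = q z` with `u` positive decreasing,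
`v` positive increasing, Wronskian one, `v / u → 0` at `-∞`, `u / v → 0` at `+∞`, and
`|(u v)'| < 1`. -/
structure IsFSS (q u v : ℝ → ℝ) : Prop where
  sol_u : IsSolution q (fun _ => 0) u
  sol_v : IsSolution q (fun _ => 0) v
  pos_u : ∀ x, 0 < u x
  pos_v : ∀ x, 0 < v x
  deriv_u_neg : ∀ x, deriv u x < 0
  deriv_v_pos : ∀ x, 0 < deriv v x
  wronskian : ∀ x, deriv v x * u x - deriv u x * v x = 1
  tendsto_atBot : Tendsto (fun x => v x / u x) atBot (𝓝 0)
  tendsto_atTop : Tendsto (fun x => u x / v x) atTop (𝓝 0)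
  abs_deriv_mul_lt : ∀ x, |deriv (fun s => u s * v s) x| < 1

/-- The Green function built from `{u, v}`. -/
def green (u v : ℝ → ℝ) (x t : ℝ) : ℝ :=
  if t ≤ x then u x * v t else u t * v x

/-- `(S f)(x) = μ(x) ∫ G(x,t) θ(t)⁻¹ f(t) dt`. -/
def opS (u v μ θ f : ℝ → ℝ) (x : ℝ) : ℝ :=
  μ x * ∫ t, green u v x t / θ t * f t

/-- `S : L_p → L_p` is (well defined and) bounded: for every `f ∈ L_p` the integral defining
`(S f)(x)` converges absolutely for almost every `x`, `S f` is in `L_p`, and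
`‖S f‖_p ≤ C ‖f‖_p` with `C` independent of `f`. -/
def BoundedS (p : ℝ≥0∞) (u v μ θ : ℝ → ℝ) : Prop :=
  ∃ C : ℝ≥0, ∀ f : ℝ → ℝ, MemLp f p volume →
    (∀ᵐ x : ℝ, Integrable (fun t => green u v x t / θ t * f t)) ∧
    MemLp (opS u v μ θ f) p volume ∧
    eLpNorm (opS u v μ θ f) p volume ≤ C * eLpNorm f p volume

end SturmLiouville

end

/-! The decaying solution `u` is squeezed out of two explicit solutions of z'' = qz, and `v` comes
from the same construction for the reflected potential q(-x). Since q ≥ 0, a solution that is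
positive and nondecreasing at a point stays so to its right. Hence `v` grows at least linearly at
+∞, and `u` at -∞.

By Hölder, non-integrability of μ at ±∞ excludes such growth from L_{p,μ} (`coeff_eq_zero_atTop`,
`coeff_eq_zero_atBot`). No nonzero Au + Bv lies in the space, so solutions there are unique. If S is
bounded, the Green potential of f is therefore the required solution (`admissible_of_boundedS`).

Conversely, for compactly supported f the Green potential is a multiple of `u` to the right of the
support and of `v` to the left. The same growth argument then identifies it with the admissible
solution (`IsFSS.eq_green_of_support`). The bound (II) for truncations of |f|/θ passes to the limit
because the kernel is nonnegative (`lintegral_green_rpow_le`), which bounds S. -/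

noncomputable section

namespace SturmLiouville

/-! ### Absolutely continuous functions as indefinite integrals -/

/-- `F` is an indefinite integral of the locally integrable function `f`. -/
structure IsPrimitive (F f : ℝ → ℝ) : Prop where
  locallyIntegrable : LocallyIntegrable f volume
  sub_eq : ∀ a b : ℝ, F b - F a = ∫ x in a..b, f x

lemma intervalIntegrable_of_locallyIntegrable {f : ℝ → ℝ} (hf : LocallyIntegrable f volume)
    (a b : ℝ) : IntervalIntegrable f volume a b :=
  (hf.integrableOn_isCompact isCompact_uIcc).intervalIntegrable

lemma locallyIntegrable_of_intervalIntegrable {f : ℝ → ℝ}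
    (hf : ∀ a b, IntervalIntegrable f volume a b) : LocallyIntegrable f volume := by
  intro x
  refine ⟨Ioc (x - 1) (x + 1), Ioc_mem_nhds (by linarith) (by linarith), ?_⟩
  exact (intervalIntegrable_iff_integrableOn_Ioc_of_le (by linarith)).1 (hf _ _)

lemma locallyIntegrable_mul_continuous {f g : ℝ → ℝ} (hf : LocallyIntegrable f volume)
    (hg : Continuous g) : LocallyIntegrable (fun x => f x * g x) volume :=
  locallyIntegrable_of_intervalIntegrable fun a b =>
    (intervalIntegrable_of_locallyIntegrable hf a b).mul_continuousOn hg.continuousOn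

lemma isPrimitive_integral {f : ℝ → ℝ} (hf : LocallyIntegrable f volume) (a : ℝ) :
    IsPrimitive (fun x => ∫ t in a..x, f t) f where
  locallyIntegrable := hf
  sub_eq _ _ := intervalIntegral.integral_interval_sub_left
    (intervalIntegrable_of_locallyIntegrable hf _ _)
    (intervalIntegrable_of_locallyIntegrable hf _ _)

namespace IsPrimitive

variable {F f G g : ℝ → ℝ}

lemma eq_add (h : IsPrimitive F f) (a : ℝ) : F = fun x => F a + ∫ t in a..x, f t := by
  ext x
  rw [← h.sub_eq]; ring

lemma absolutelyContinuous (h : IsPrimitive F f) (a b : ℝ) :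
    AbsolutelyContinuousOnInterval F a b := by
  rw [h.eq_add a]
  have h1 := (intervalIntegrable_of_locallyIntegrable h.locallyIntegrable
    a b).absolutelyContinuousOnInterval_intervalIntegral (c := a) (by simp)
  have h2 : AbsolutelyContinuousOnInterval (fun _ : ℝ => F a) a b :=
    (LipschitzWith.const (F a)).lipschitzOnWith.absolutelyContinuousOnInterval
  exact h2.fun_add h1

lemma continuous (h : IsPrimitive F f) : Continuous F := by
  rw [continuous_iff_continuousAt]
  intro x
  have := (h.absolutelyContinuous (x - 1) (x + 1)).continuousOn
  rw [uIcc_of_le (by linarith)] at this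
  exact this.continuousAt (Icc_mem_nhds (by linarith) (by linarith))

lemma ae_hasDerivAt (h : IsPrimitive F f) : ∀ᵐ x : ℝ, HasDerivAt F (f x) x := by
  filter_upwards [LocallyIntegrable.ae_hasDerivAt_integral h.locallyIntegrable] with x hx
  rw [h.eq_add 0]
  exact (hx 0).const_add _

lemma hasDerivAt (h : IsPrimitive F f) (hf : Continuous f) (x : ℝ) : HasDerivAt F (f x) x := by
  rw [h.eq_add 0]
  exact (hf.integral_hasStrictDerivAt 0 x).hasDerivAt.const_add _

/-- The fundamental theorem of calculus for absolutely continuous functions. The calculus rules for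
sums, products and compositions reduce to it: absolute continuity plus an almost everywhere
derivative. -/
lemma of_absolutelyContinuous (hF : ∀ a b, AbsolutelyContinuousOnInterval F a b)
    (hf : ∀ᵐ x : ℝ, HasDerivAt F (f x) x) : IsPrimitive F f := by
  have h1 : f =ᵐ[volume] deriv F := by
    filter_upwards [hf] with x hx
    exact hx.deriv.symm
  refine ⟨?_, fun a b => ?_⟩
  · apply locallyIntegrable_of_intervalIntegrable
    intro a b
    exact (hF a b).intervalIntegrable_deriv.congr_ae (ae_restrict_of_ae h1.symm)
  · rw [← (hF a b).integral_deriv_eq_sub]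
    apply intervalIntegral.integral_congr_ae
    filter_upwards [h1] with x hx _ using hx.symm

lemma congr (h : IsPrimitive F f) (hfg : f =ᵐ[volume] g) : IsPrimitive F g :=
  of_absolutelyContinuous h.absolutelyContinuous (by
    filter_upwards [h.ae_hasDerivAt, hfg] with x hx hx' using hx' ▸ hx)

lemma add (hF : IsPrimitive F f) (hG : IsPrimitive G g) :
    IsPrimitive (fun x => F x + G x) (fun x => f x + g x) :=
  of_absolutelyContinuous (fun a b => (hF.absolutelyContinuous a b).fun_add
    (hG.absolutelyContinuous a b)) (by
    filter_upwards [hF.ae_hasDerivAt, hG.ae_hasDerivAt] with x hx hx' using hx.add hx')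

lemma mul (hF : IsPrimitive F f) (hG : IsPrimitive G g) :
    IsPrimitive (fun x => F x * G x) (fun x => f x * G x + F x * g x) :=
  of_absolutelyContinuous (fun a b => (hF.absolutelyContinuous a b).fun_mul
    (hG.absolutelyContinuous a b)) (by
    filter_upwards [hF.ae_hasDerivAt, hG.ae_hasDerivAt] with x hx hx' using hx.mul hx')

lemma const_mul (c : ℝ) (hF : IsPrimitive F f) :
    IsPrimitive (fun x => c * F x) (fun x => c * f x) :=
  of_absolutelyContinuous (fun a b => (hF.absolutelyContinuous a b).const_mul c) (by
    filter_upwards [hF.ae_hasDerivAt] with x hx using hx.const_mul c)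

lemma sub (hF : IsPrimitive F f) (hG : IsPrimitive G g) :
    IsPrimitive (fun x => F x - G x) (fun x => f x - g x) :=
  of_absolutelyContinuous (fun a b => (hF.absolutelyContinuous a b).fun_sub
    (hG.absolutelyContinuous a b)) (by
    filter_upwards [hF.ae_hasDerivAt, hG.ae_hasDerivAt] with x hx hx' using hx.sub hx')

lemma comp_neg (hF : IsPrimitive F f) : IsPrimitive (fun x => F (-x)) (fun x => -f (-x)) := by
  refine ⟨?_, fun a b => ?_⟩
  · apply locallyIntegrable_of_intervalIntegrable
    intro a b
    have :=
      (intervalIntegrable_of_locallyIntegrable hF.locallyIntegrable (-a) (-b)).comp_sub_left 0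
    simp only [neg_neg, zero_sub] at this
    exact this.neg
  · rw [intervalIntegral.integral_neg, intervalIntegral.integral_comp_neg, hF.sub_eq,
      intervalIntegral.integral_symm]

lemma of_hasDerivAt (hF : ∀ x, HasDerivAt F (f x) x) (hf : Continuous f) : IsPrimitive F f :=
  ⟨hf.locallyIntegrable, fun a b => (intervalIntegral.integral_eq_sub_of_hasDerivAt
    (fun x _ => hF x) (hf.intervalIntegrable a b)).symm⟩

lemma mono (hF : IsPrimitive F f) {a b : ℝ} (hab : a ≤ b)
    (hf : ∀ᵐ x : ℝ, x ∈ Icc a b → 0 ≤ f x) : F a ≤ F b := by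
  have := intervalIntegral.integral_nonneg_of_ae_restrict (μ := volume) hab
    ((ae_restrict_iff' measurableSet_Icc).2 hf)
  linarith [hF.sub_eq a b]

/-- A `C¹` function composed with a primitive is a primitive. -/
lemma comp {φ φ' : ℝ → ℝ} (hφ : ContDiff ℝ 1 φ) (hφ' : ∀ x, HasDerivAt φ (φ' x) x)
    (hF : IsPrimitive F f) : IsPrimitive (fun x => φ (F x)) (fun x => φ' (F x) * f x) := by
  refine of_absolutelyContinuous (fun a b => ?_) ?_
  -- `F` is bounded on the interval and φ is Lipschitz on the compact range [-C, C], so absolute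
  -- continuity survives. Below, ε / (K + 1) also covers K = 0.
  · obtain ⟨C, hC⟩ := (hF.absolutelyContinuous a b).exists_bound
    obtain ⟨K, hK⟩ := (hφ.contDiffOn (s := Icc (-C) C)).exists_lipschitzOnWith (by decide)
      (convex_Icc _ _) isCompact_Icc
    have hac := hF.absolutelyContinuous a b
    rw [absolutelyContinuousOnInterval_iff] at hac ⊢
    intro ε hε
    obtain ⟨δ, hδ, h⟩ := hac (ε / (K + 1)) (by positivity)
    refine ⟨δ, hδ, fun E hE hE' => ?_⟩
    have h1 := h E hE hE'
    have h2 : ∑ i ∈ Finset.range E.1, dist (φ (F (E.2 i).1)) (φ (F (E.2 i).2)) ≤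
        K * ∑ i ∈ Finset.range E.1, dist (F (E.2 i).1) (F (E.2 i).2) := by
      rw [Finset.mul_sum]
      refine Finset.sum_le_sum fun i hi => ?_
      have hm := hE.1 i hi
      exact hK.dist_le_mul _ (abs_le.1 (hC _ hm.1)) _ (abs_le.1 (hC _ hm.2))
    have h3 : 0 ≤ ∑ i ∈ Finset.range E.1, dist (F (E.2 i).1) (F (E.2 i).2) :=
      Finset.sum_nonneg fun _ _ => dist_nonneg
    rw [lt_div_iff₀ (by positivity)] at h1
    nlinarith [K.coe_nonneg]
  · filter_upwards [hF.ae_hasDerivAt] with x hx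
    exact (hφ' (F x)).comp x hx

end IsPrimitive

/-! ### Solutions: first-order form, linearity, reflection, Wronskian -/

namespace IsSolution

variable {q f y z : ℝ → ℝ}

lemma hasDerivAt (h : IsSolution q f y) (x : ℝ) : HasDerivAt y (deriv y x) x :=
  (h.differentiable x).hasDerivAt

lemma isPrimitive_deriv (h : IsSolution q f y) :
    IsPrimitive (deriv y) (fun x => q x * y x - f x) := by
  refine IsPrimitive.of_absolutelyContinuous h.ac_deriv ?_
  -- `deriv (deriv y)` is 0 by default where y' is not differentiable, so the equation alone does
  -- not give a derivative of y'. Absolute continuity on each [-n, n] supplies differentiability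
  -- almost everywhere.
  have hd : ∀ᵐ x : ℝ, ∀ n : ℕ, x ∈ uIcc (-n : ℝ) n → DifferentiableAt ℝ (deriv y) x :=
    ae_all_iff.2 fun n => (h.ac_deriv (-n) n).ae_differentiableAt
  filter_upwards [h.eq_ae, hd] with x hx hx'
  obtain ⟨n, hn⟩ := exists_nat_ge |x|
  have := (hx' n (by
    rw [uIcc_of_le (by linarith [abs_nonneg x])]; exact abs_le.1 hn)).hasDerivAt
  rwa [show q x * y x - f x = deriv (deriv y) x by linarith]

lemma continuous (h : IsSolution q f y) : Continuous y := h.differentiable.continuous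

lemma continuous_deriv (h : IsSolution q f y) : Continuous (deriv y) :=
  h.isPrimitive_deriv.continuous

lemma isPrimitive (h : IsSolution q f y) : IsPrimitive y (deriv y) :=
  .of_hasDerivAt h.hasDerivAt h.continuous_deriv

lemma of_hasDerivAt (hy : ∀ x, HasDerivAt y (z x) x)
    (hz : IsPrimitive z (fun x => q x * y x - f x)) : IsSolution q f y := by
  have hd : deriv y = z := funext fun x => (hy x).deriv
  refine ⟨fun x => (hy x).differentiableAt,
    (IsPrimitive.of_hasDerivAt hy hz.continuous).absolutelyContinuous, ?_, ?_⟩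
  · rw [hd]; exact hz.absolutelyContinuous
  · rw [hd]
    filter_upwards [hz.ae_hasDerivAt] with x hx
    rw [hx.deriv]; ring

lemma comb {f₁ f₂ y₁ y₂ : ℝ → ℝ} (h₁ : IsSolution q f₁ y₁) (h₂ : IsSolution q f₂ y₂) (a b : ℝ) :
    IsSolution q (fun x => a * f₁ x + b * f₂ x) (fun x => a * y₁ x + b * y₂ x) := by
  refine of_hasDerivAt (z := fun x => a * deriv y₁ x + b * deriv y₂ x)
    (fun x => ((h₁.hasDerivAt x).const_mul a).add ((h₂.hasDerivAt x).const_mul b)) ?_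
  refine ((h₁.isPrimitive_deriv.const_mul a).add (h₂.isPrimitive_deriv.const_mul b)).congr ?_
  exact .of_forall fun x => by ring

lemma comb_zero {y₁ y₂ : ℝ → ℝ} (h₁ : IsSolution q (fun _ => 0) y₁)
    (h₂ : IsSolution q (fun _ => 0) y₂) (a b : ℝ) :
    IsSolution q (fun _ => 0) (fun x => a * y₁ x + b * y₂ x) := by
  simpa using h₁.comb h₂ a b

lemma deriv_comb {f₁ f₂ y₁ y₂ : ℝ → ℝ} (h₁ : IsSolution q f₁ y₁) (h₂ : IsSolution q f₂ y₂)
    (a b x : ℝ) :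
    deriv (fun x => a * y₁ x + b * y₂ x) x = a * deriv y₁ x + b * deriv y₂ x :=
  (((h₁.hasDerivAt x).const_mul a).add ((h₂.hasDerivAt x).const_mul b)).deriv

lemma sub_zero {y₁ y₂ : ℝ → ℝ} (h₁ : IsSolution q f y₁) (h₂ : IsSolution q f y₂) :
    IsSolution q (fun _ => 0) (fun x => y₁ x - y₂ x) := by
  have := h₁.comb h₂ 1 (-1)
  simp only [one_mul, neg_mul, ← sub_eq_add_neg, sub_self] at this
  exact this

lemma hasDerivAt_comp_neg (h : IsSolution q f y) (x : ℝ) :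
    HasDerivAt (fun x => y (-x)) (-deriv y (-x)) x := by
  have := (h.hasDerivAt (-x)).comp x (hasDerivAt_neg x)
  rwa [mul_neg_one] at this

lemma comp_neg (h : IsSolution q f y) :
    IsSolution (fun x => q (-x)) (fun x => f (-x)) (fun x => y (-x)) := by
  refine of_hasDerivAt h.hasDerivAt_comp_neg ?_
  have := h.isPrimitive_deriv.comp_neg.const_mul (-1)
  simpa only [neg_one_mul, neg_neg] using this

/-- The Wronskian of two solutions of the homogeneous equation is constant. -/
lemma wronskian_eq {y₁ y₂ : ℝ → ℝ} (h₁ : IsSolution q (fun _ => 0) y₁)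
    (h₂ : IsSolution q (fun _ => 0) y₂) (a b : ℝ) :
    deriv y₂ a * y₁ a - deriv y₁ a * y₂ a = deriv y₂ b * y₁ b - deriv y₁ b * y₂ b := by
  have h := (h₂.isPrimitive_deriv.mul h₁.isPrimitive).sub
    (h₁.isPrimitive_deriv.mul h₂.isPrimitive)
  have h' : IsPrimitive _ (fun _ => (0 : ℝ)) := h.congr (.of_forall fun x => by ring)
  have := h'.sub_eq a b
  simp only [intervalIntegral.integral_zero] at this
  linarith

end IsSolution

/-! ### The initial value problem by a weighted contraction -/

section InitialValueProblem

open BoundedContinuousFunction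

/-- As Q' = g, the integrand is the derivative of exp(2Q)/2. The factor 2 in the exponent is what
yields the contraction constant 1/2. -/
lemma IsPrimitive.integral_mul_exp_le_of_nonneg {Q g : ℝ → ℝ} (hQ : IsPrimitive Q g)
    (hg : ∀ x, 0 ≤ g x) (hQ0 : Q 0 = 0) {x : ℝ} (hx : 0 ≤ x) :
    |∫ t in (0 : ℝ)..x, g t * Real.exp (2 * |Q t|)| ≤ Real.exp (2 * |Q x|) / 2 := by
  have hpos : ∀ t, 0 ≤ t → 0 ≤ Q t := fun t ht => by
    have := hQ.mono ht (.of_forall fun x _ => hg x)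
    rwa [hQ0] at this
  have h1 : ∫ t in (0 : ℝ)..x, g t * Real.exp (2 * |Q t|) =
      ∫ t in (0 : ℝ)..x, Real.exp (2 * Q t) * g t := by
    apply intervalIntegral.integral_congr
    intro t ht
    rw [uIcc_of_le hx] at ht
    simp only [abs_of_nonneg (hpos t ht.1)]
    ring
  have h2 : IsPrimitive (fun x => 1 / 2 * Real.exp (2 * Q x))
      (fun x => Real.exp (2 * Q x) * g x) := by
    have := hQ.comp (φ := fun x => 1 / 2 * Real.exp (2 * x)) (φ' := fun x => Real.exp (2 * x))
      (by fun_prop) (fun x => by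
        have h := (((hasDerivAt_id x).const_mul 2).exp).const_mul (1 / 2)
        exact h.congr_deriv (by simp only [id]; ring))
    exact this
  have h3 := h2.sub_eq 0 x
  rw [h1, ← h3, abs_of_nonneg, abs_of_nonneg (hpos x hx), hQ0]
  · simp; linarith
  · rw [h3]
    exact intervalIntegral.integral_nonneg hx fun t _ => mul_nonneg (Real.exp_pos _).le (hg t)

lemma IsPrimitive.integral_mul_exp_le {Q g : ℝ → ℝ} (hQ : IsPrimitive Q g)
    (hg : ∀ x, 0 ≤ g x) (hQ0 : Q 0 = 0) (x : ℝ) :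
    |∫ t in (0 : ℝ)..x, g t * Real.exp (2 * |Q t|)| ≤ Real.exp (2 * |Q x|) / 2 := by
  rcases le_total 0 x with hx | hx
  · exact hQ.integral_mul_exp_le_of_nonneg hg hQ0 hx
  · have h : IsPrimitive (fun x => -Q (-x)) (fun x => g (-x)) := by
      simpa only [neg_one_mul, neg_neg] using hQ.comp_neg.const_mul (-1)
    have := h.integral_mul_exp_le_of_nonneg (fun x => hg _) (by simpa using hQ0)
      (x := -x) (by linarith)
    simp only [abs_neg, neg_neg] at this
    rw [intervalIntegral.integral_comp_neg (fun t => g t * Real.exp (2 * |Q t|)),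
      intervalIntegral.integral_symm] at this
    simpa using this

/-- The Volterra operator with kernel `k`, in the weighted supremum norm with weight
`exp (2 |Q|)`, `Q' ≥ |k|`, is a contraction. -/
lemma exists_volterra_contraction {Q g k : ℝ → ℝ} (hQ : IsPrimitive Q g)
    (hQ0 : Q 0 = 0) (hk : LocallyIntegrable k volume) (hkg : ∀ x, |k x| ≤ g x) (a : ℝ) :
    ∃ J : (ℝ →ᵇ ℝ) → (ℝ →ᵇ ℝ),
      (∀ w x, J w x = (a + ∫ t in (0 : ℝ)..x, k t * (Real.exp (2 * |Q t|) * w t)) /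
        Real.exp (2 * |Q x|)) ∧
      ∀ w w', dist (J w) (J w') ≤ 1 / 2 * dist w w' := by
  have hW : Continuous fun x => Real.exp (2 * |Q x|) := by
    have := hQ.continuous; fun_prop
  have hint : ∀ w : ℝ →ᵇ ℝ, LocallyIntegrable
      (fun t => k t * (Real.exp (2 * |Q t|) * w t)) volume := fun w =>
    locallyIntegrable_mul_continuous hk (hW.mul w.continuous)
  have hbound : ∀ (w : ℝ →ᵇ ℝ) x,
      |∫ t in (0 : ℝ)..x, k t * (Real.exp (2 * |Q t|) * w t)| ≤
        1 / 2 * ‖w‖ * Real.exp (2 * |Q x|) := by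
    intro w x
    have h1 : |∫ t in (0 : ℝ)..x, k t * (Real.exp (2 * |Q t|) * w t)| ≤
        |∫ t in (0 : ℝ)..x, (g t * Real.exp (2 * |Q t|)) * ‖w‖| := by
      refine intervalIntegral.norm_integral_le_abs_of_norm_le (E := ℝ) (.of_forall fun t => ?_) ?_
      · rw [Real.norm_eq_abs, abs_mul, abs_mul, Real.abs_exp, ← mul_assoc]
        gcongr
        · exact mul_nonneg ((abs_nonneg _).trans (hkg t)) (Real.exp_pos _).le
        · exact hkg t
        · exact w.norm_coe_le_norm t
      · exact intervalIntegrable_of_locallyIntegrable (locallyIntegrable_mul_continuous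
          (locallyIntegrable_mul_continuous hQ.locallyIntegrable hW) continuous_const) _ _
    rw [intervalIntegral.integral_mul_const, abs_mul, abs_of_nonneg (norm_nonneg w)] at h1
    have h2 := hQ.integral_mul_exp_le (fun x => (abs_nonneg _).trans (hkg x)) hQ0 x
    nlinarith [norm_nonneg w]
  have hcont : ∀ w : ℝ →ᵇ ℝ, Continuous fun x =>
      (a + ∫ t in (0 : ℝ)..x, k t * (Real.exp (2 * |Q t|) * w t)) / Real.exp (2 * |Q x|) :=
    fun w => (continuous_const.add (isPrimitive_integral (hint w) 0).continuous).div hW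
      fun x => (Real.exp_pos _).ne'
  refine ⟨fun w => BoundedContinuousFunction.ofNormedAddCommGroup _ (hcont w)
    (|a| + 1 / 2 * ‖w‖) fun x => ?_, fun w x => rfl, fun w w' => ?_⟩
  · rw [Real.norm_eq_abs, abs_div, Real.abs_exp, div_le_iff₀ (Real.exp_pos _)]
    have h1 : 1 ≤ Real.exp (2 * |Q x|) := Real.one_le_exp (by positivity)
    have h2 := abs_add_le a (∫ t in (0 : ℝ)..x, k t * (Real.exp (2 * |Q t|) * w t))
    nlinarith [hbound w x, abs_nonneg a]
  · rw [BoundedContinuousFunction.dist_le (by positivity)]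
    intro x
    change |(a + _) / _ - (a + _) / _| ≤ _
    rw [ ← sub_div, add_sub_add_left_eq_sub, ← intervalIntegral.integral_sub
      (intervalIntegrable_of_locallyIntegrable (hint w) _ _)
      (intervalIntegrable_of_locallyIntegrable (hint w') _ _), abs_div, Real.abs_exp,
      div_le_iff₀ (Real.exp_pos _), dist_eq_norm]
    refine le_of_eq_of_le (congrArg abs (intervalIntegral.integral_congr fun t _ => ?_))
      (hbound (w - w') x)
    simp only [BoundedContinuousFunction.sub_apply]
    ring

/-- Solvability of the initial value problem for `y'' = q y` with locally integrable `q`. -/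
lemma exists_isSolution {q : ℝ → ℝ} (hq : LocallyIntegrable q volume) (a b : ℝ) :
    ∃ y, IsSolution q (fun _ => 0) y ∧ y 0 = a ∧ deriv y 0 = b := by
  -- 1 + |q| dominates both kernels of the system y' = z, z' = qy, namely 1 and q, so one weight
  -- serves for both equations.
  have hg : LocallyIntegrable (fun x => 1 + |q x|) volume :=
    (locallyIntegrable_const (1 : ℝ)).add (locallyIntegrable_of_intervalIntegrable
      fun a b => (intervalIntegrable_of_locallyIntegrable hq a b).norm)
  set Q : ℝ → ℝ := fun x => ∫ t in (0 : ℝ)..x, (1 + |q t|) with hQdef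
  have hQ : IsPrimitive Q _ := isPrimitive_integral hg 0
  have hQ0 : Q 0 = 0 := by simp [hQdef]
  obtain ⟨J₁, hJ₁, hd₁⟩ := exists_volterra_contraction hQ hQ0
    (locallyIntegrable_const (1 : ℝ)) (fun x => by simp) a
  obtain ⟨J₂, hJ₂, hd₂⟩ := exists_volterra_contraction hQ hQ0 hq (fun x => by simp) b
  -- The unknowns are y and z divided by the weight. Each equation integrates the other unknown, and
  -- the maximum metric on the product keeps the constant 1/2.
  let T : (ℝ →ᵇ ℝ) × (ℝ →ᵇ ℝ) → (ℝ →ᵇ ℝ) × (ℝ →ᵇ ℝ) := fun p => (J₁ p.2, J₂ p.1)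
  have hT : ContractingWith (1 / 2) T := by
    refine ⟨by rw [← NNReal.coe_lt_coe]; norm_num, LipschitzWith.of_dist_le_mul fun p p' => ?_⟩
    have e : ((1 / 2 : ℝ≥0) : ℝ) = 1 / 2 := by norm_num
    rw [e, Prod.dist_eq]
    refine max_le ((hd₁ _ _).trans ?_) ((hd₂ _ _).trans ?_)
    · gcongr; exact le_max_right _ _
    · gcongr; exact le_max_left _ _
  set p := ContractingWith.fixedPoint T hT
  have hp : T p = p := hT.fixedPoint_isFixedPt
  have hp1 : J₁ p.2 = p.1 := congrArg Prod.fst hp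
  have hp2 : J₂ p.1 = p.2 := congrArg Prod.snd hp
  set y : ℝ → ℝ := fun x => Real.exp (2 * |Q x|) * p.1 x with hy
  set z : ℝ → ℝ := fun x => Real.exp (2 * |Q x|) * p.2 x with hz
  have hW : Continuous fun x => Real.exp (2 * |Q x|) := by
    have := hQ.continuous; fun_prop
  have hyc : Continuous y := hW.mul p.1.continuous
  have hzc : Continuous z := hW.mul p.2.continuous
  have hye : ∀ x, y x = a + ∫ t in (0 : ℝ)..x, z t := fun x => by
    have := hJ₁ p.2 x
    rw [hp1, eq_div_iff (Real.exp_pos _).ne'] at this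
    rw [hy]
    simp only [one_mul] at this
    linarith
  have hze : ∀ x, z x = b + ∫ t in (0 : ℝ)..x, q t * y t := fun x => by
    have := hJ₂ p.1 x
    rw [hp2, eq_div_iff (Real.exp_pos _).ne'] at this
    rw [hz]
    linarith
  have hyd : ∀ x, HasDerivAt y (z x) x := fun x => by
    rw [show y = fun x => a + ∫ t in (0 : ℝ)..x, z t from funext hye]
    exact (hzc.integral_hasStrictDerivAt 0 x).hasDerivAt.const_add _
  refine ⟨y, IsSolution.of_hasDerivAt hyd ⟨?_, fun c d => ?_⟩, by simp [hye], ?_⟩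
  · simpa using locallyIntegrable_mul_continuous hq hyc
  · have := (isPrimitive_integral (locallyIntegrable_mul_continuous hq hyc) 0).sub_eq c d
    rw [hze, hze]
    simp only [_root_.sub_zero]
    linarith
  · rw [(hyd 0).deriv, hze]; simp

end InitialValueProblem

/-! ### Positivity and the fundamental system -/

lemma ae_nonneg_comp_neg {q : ℝ → ℝ} (h : ∀ᵐ x : ℝ, 0 ≤ q x) : ∀ᵐ x : ℝ, 0 ≤ q (-x) :=
  (Measure.measurePreserving_neg (volume : Measure ℝ)).quasiMeasurePreserving.ae h

/-- (zz')' = z'² + qz² ≥ 0 whatever the sign of z. So zz' stays nonnegative, z² does not decrease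
and z cannot reach 0; then z'' = qz ≥ 0 makes z' nondecreasing. -/
lemma IsSolution.pos_of_le {q z : ℝ → ℝ} (hq : ∀ᵐ x : ℝ, 0 ≤ q x)
    (hz : IsSolution q (fun _ => 0) z) {a x : ℝ} (ha : 0 < z a) (ha' : 0 ≤ deriv z a)
    (hx : a ≤ x) : 0 < z x ∧ deriv z a ≤ deriv z x := by
  have hzz : ∀ t, a ≤ t → 0 ≤ z t * deriv z t := fun t ht => by
    have := (hz.isPrimitive.mul hz.isPrimitive_deriv).mono ht (by
      filter_upwards [hq] with s hs _
      nlinarith [mul_nonneg hs (sq_nonneg (z s)), sq_nonneg (deriv z s)])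
    exact (mul_nonneg ha.le ha').trans this
  have hsq : ∀ t, a ≤ t → z a * z a ≤ z t * z t := fun t ht => by
    refine (hz.isPrimitive.mul hz.isPrimitive).mono ht (.of_forall fun s hs => ?_)
    linarith [hzz s hs.1]
  have hpos : ∀ t, a ≤ t → 0 < z t := by
    intro t ht
    by_contra! hcon
    obtain ⟨s, hs, hs0⟩ := intermediate_value_Icc' ht hz.continuous.continuousOn ⟨hcon, ha.le⟩
    have := hsq s hs.1
    rw [hs0] at this
    nlinarith
  refine ⟨hpos x hx, hz.isPrimitive_deriv.mono hx ?_⟩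
  filter_upwards [hq] with s hs hs'
  have := mul_nonneg hs (hpos s hs'.1).le
  linarith

lemma IsSolution.pos_of_ge {q z : ℝ → ℝ} (hq : ∀ᵐ x : ℝ, 0 ≤ q x)
    (hz : IsSolution q (fun _ => 0) z) {a x : ℝ} (ha : 0 < z a) (ha' : deriv z a ≤ 0)
    (hx : x ≤ a) : 0 < z x ∧ deriv z x ≤ deriv z a := by
  have := hz.comp_neg.pos_of_le (ae_nonneg_comp_neg hq) (a := -a) (x := -x) (by simpa using ha)
    (by rw [(hz.hasDerivAt_comp_neg _).deriv]; simpa using ha') (by linarith)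
  rw [(hz.hasDerivAt_comp_neg _).deriv, (hz.hasDerivAt_comp_neg _).deriv] at this
  simpa using this

/-- If u'(x) = 0, convexity and u' ≤ 0 force u' = 0 on [x, ∞). Then qu = 0 almost everywhere there,
so q has no mass to the right of x. -/
lemma deriv_neg_of_nonpos {q u : ℝ → ℝ} (hq : ∀ᵐ x : ℝ, 0 ≤ q x)
    (hq_right : ∀ x : ℝ, 0 < ∫⁻ t in Ici x, ENNReal.ofReal (q t))
    (hu : IsSolution q (fun _ => 0) u) (hpos : ∀ x, 0 ≤ x → 0 < u x)
    (hle : ∀ x, 0 ≤ x → deriv u x ≤ 0) {x : ℝ} (hx : 0 ≤ x) : deriv u x < 0 := by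
  refine lt_of_le_of_ne (hle x hx) fun h0 => (hq_right x).ne' ?_
  have hzero : ∀ t, x ≤ t → deriv u t = 0 := fun t ht => by
    have := (hu.pos_of_le hq (hpos x hx) h0.ge ht).2
    linarith [hle t (hx.trans ht)]
  have hd : ∀ᵐ t : ℝ, t ∈ Ioi x → q t = 0 := by
    filter_upwards [hu.isPrimitive_deriv.ae_hasDerivAt] with t ht htx
    have h1 : HasDerivAt (deriv u) 0 t := by
      refine (hasDerivAt_const t (0 : ℝ)).congr_of_eventuallyEq ?_
      filter_upwards [Ioi_mem_nhds htx] with s hs using hzero s (le_of_lt hs)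
    have h2 := ht.unique h1
    have h3 := hpos t (hx.trans (le_of_lt htx))
    rw [_root_.sub_zero] at h2
    exact (mul_eq_zero.1 h2).resolve_right h3.ne'
  rw [setLIntegral_congr Ioi_ae_eq_Ici.symm, lintegral_eq_zero_iff' ?_]
  · rw [EventuallyEq, ae_restrict_iff' measurableSet_Ioi]
    filter_upwards [hd] with t ht htx
    simp [ht htx]
  · refine AEMeasurable.congr (f := fun _ => 0) aemeasurable_const ?_
    rw [EventuallyEq, ae_restrict_iff' measurableSet_Ioi]
    filter_upwards [hd] with t ht htx
    simp [ht htx]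

/-- Existence of a positive strictly decreasing solution of `u'' = q u`. -/
lemma exists_pos_decreasing {q : ℝ → ℝ} (hq : ∀ᵐ x : ℝ, 0 ≤ q x)
    (hq_loc : LocallyIntegrable q volume)
    (hq_right : ∀ x : ℝ, 0 < ∫⁻ t in Ici x, ENNReal.ofReal (q t)) :
    ∃ u, IsSolution q (fun _ => 0) u ∧ ∀ x, 0 < u x ∧ deriv u x < 0 := by
  obtain ⟨φ, hφ, hφ0, hφ0'⟩ := exists_isSolution hq_loc 1 0
  obtain ⟨ψ, hψ, hψ0, hψ0'⟩ := exists_isSolution hq_loc 1 1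
  have hψpos : ∀ x, 0 ≤ x → 0 < ψ x ∧ 1 ≤ deriv ψ x := fun x hx => by
    have := hψ.pos_of_le hq (a := 0) (by simp [hψ0]) (by simp [hψ0']) hx
    rwa [hψ0'] at this
  have hw : ∀ x, deriv ψ x * φ x - deriv φ x * ψ x = 1 := fun x => by
    rw [hφ.wronskian_eq hψ x 0, hφ0, hφ0', hψ0, hψ0']; norm_num
  -- For fixed y this solution takes the value 1 (the Wronskian) with derivative 0 at y, so it is
  -- positive on both sides of y.
  have hcmp : ∀ y x, 0 < deriv ψ y * φ x + -deriv φ y * ψ x := fun y x => by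
    have hs := hφ.comb_zero hψ (deriv ψ y) (-deriv φ y)
    have h0 : deriv (fun x => deriv ψ y * φ x + -deriv φ y * ψ x) y = 0 := by
      rw [hφ.deriv_comb hψ]; ring
    have h1 : 0 < deriv ψ y * φ y + -deriv φ y * ψ y := by
      have := hw y; linarith
    rcases le_total y x with h | h
    · exact (hs.pos_of_le hq h1 h0.ge h).1
    · exact (hs.pos_of_ge hq h1 h0.le h).1
  -- By `hcmp`, every φ'(y)/ψ'(y) lies below every φ(x)/ψ(x) on [0, ∞). A number m separating the
  -- two families gives u = φ - mψ with u ≥ 0 ≥ u'.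
  set m : ℝ := sSup ((fun y => deriv φ y / deriv ψ y) '' Ici 0) with hm
  have hbd : ∀ x, 0 ≤ x → ∀ y ∈ (fun y => deriv φ y / deriv ψ y) '' Ici 0, y ≤ φ x / ψ x := by
    rintro x hx _ ⟨y, hy, rfl⟩
    have h1 := (hψpos y hy).2
    rw [div_le_div_iff₀ (by linarith) (hψpos x hx).1]
    linarith [hcmp y x]
  have hm_ge : ∀ y, 0 ≤ y → deriv φ y ≤ m * deriv ψ y := fun y hy => by
    have h1 := (hψpos y hy).2
    rw [← div_le_iff₀ (by linarith)]
    exact le_csSup ⟨_, hbd 0 le_rfl⟩ ⟨y, hy, rfl⟩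
  have hm_le : ∀ x, 0 ≤ x → m * ψ x ≤ φ x := fun x hx => by
    rw [← le_div_iff₀ (hψpos x hx).1]
    exact csSup_le (nonempty_Ici.image _) (hbd x hx)
  have hu := hφ.comb_zero hψ 1 (-m)
  have hderiv := fun x => hφ.deriv_comb hψ 1 (-m) x
  set u : ℝ → ℝ := fun x => 1 * φ x + -m * ψ x with hudef
  have hle : ∀ x, 0 ≤ x → deriv u x ≤ 0 := fun x hx => by
    rw [hderiv]; linarith [hm_ge x hx]
  have hpos : ∀ x, 0 ≤ x → 0 < u x := fun x hx => by
    have hnn : ∀ t, 0 ≤ t → 0 ≤ u t := fun t ht => by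
      simp only [hudef]; linarith [hm_le t ht]
    refine lt_of_le_of_ne (hnn x hx) fun h0 => ?_
    have hz : ∀ t, x ≤ t → u t = 0 := fun t ht => by
      -- A nonnegative nonincreasing u that vanishes at x vanishes from x on, which contradicts its
      -- Wronskian 1 with ψ.
      have := hu.isPrimitive.comp_neg.mono (a := -t) (b := -x) (by linarith)
        (.of_forall fun t ht => by linarith [hle (-t) (by linarith [ht.2])])
      simp only [neg_neg] at this
      linarith [hnn t (hx.trans ht)]
    have hd : deriv u (x + 1) = 0 := by
      refine ((hasDerivAt_const (x + 1) (0 : ℝ)).congr_of_eventuallyEq ?_).deriv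
      filter_upwards [Ioi_mem_nhds (lt_add_one x)] with s hs using hz s (le_of_lt hs)
    have h1 : deriv ψ (x + 1) * u (x + 1) - deriv u (x + 1) * ψ (x + 1) = 1 := by
      rw [hderiv]; simp only [hudef]; linarith [hw (x + 1)]
    rw [hd, hz (x + 1) (by linarith)] at h1
    norm_num at h1
  refine ⟨u, hu, fun x => ?_⟩
  rcases le_total 0 x with hx | hx
  · exact ⟨hpos x hx, deriv_neg_of_nonpos hq hq_right hu hpos hle hx⟩
  · have h0 := deriv_neg_of_nonpos hq hq_right hu hpos hle le_rfl
    have := hu.pos_of_ge hq (hpos 0 le_rfl) h0.le hx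
    exact ⟨this.1, by linarith⟩

/-- To the right of 0, v' ≥ v'(0), hence v(x) ≥ v(0) + v'(0)x. -/
lemma linear_growth {q v : ℝ → ℝ} (hq : ∀ᵐ x : ℝ, 0 ≤ q x)
    (hv : IsSolution q (fun _ => 0) v) (h0 : 0 < v 0) (h0' : 0 < deriv v 0) :
    ∃ c > 0, ∀ x, 0 ≤ x → c * (1 + x) ≤ v x := by
  refine ⟨min (v 0) (deriv v 0), lt_min h0 h0', fun x hx => ?_⟩
  have h1 : IsPrimitive (fun x => v x - deriv v 0 * x) (fun x => deriv v x - deriv v 0) := by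
    refine .of_hasDerivAt (fun x => (hv.hasDerivAt x).sub ?_)
      (hv.continuous_deriv.sub continuous_const)
    simpa using (hasDerivAt_id x).const_mul (deriv v 0)
  have h2 := h1.mono hx (.of_forall fun t ht => by
    linarith [(hv.pos_of_le hq h0 h0'.le ht.1).2])
  simp only [mul_zero, _root_.sub_zero] at h2
  nlinarith [min_le_left (v 0) (deriv v 0), min_le_right (v 0) (deriv v 0)]

lemma tendsto_div_of_growth {q u v : ℝ → ℝ} (hq : ∀ᵐ x : ℝ, 0 ≤ q x)
    (hv : IsSolution q (fun _ => 0) v)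
    (hu_pos : ∀ x, 0 < u x) (hu' : ∀ x, deriv u x < 0) (hv0 : 0 < v 0) (hv0' : 0 < deriv v 0) :
    Tendsto (fun x => u x / v x) atTop (𝓝 0) := by
  obtain ⟨c, hc, hcv⟩ := linear_growth hq hv hv0 hv0'
  have hv_top : Tendsto v atTop atTop := by
    refine tendsto_atTop_mono' atTop (f₁ := fun x => c * (1 + x)) ?_ ?_
    · filter_upwards [eventually_ge_atTop 0] with x hx using hcv x hx
    · exact (tendsto_atTop_add_const_left _ _ tendsto_id).const_mul_atTop hc
  have hlim : Tendsto (fun x => u 0 / v x) atTop (𝓝 0) := hv_top.const_div_atTop _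
  have hanti : Antitone u := (strictAnti_of_deriv_neg hu').antitone
  refine squeeze_zero' ?_ ?_ hlim
  · filter_upwards [eventually_ge_atTop 0] with x hx
    exact div_nonneg (hu_pos x).le (hv.pos_of_le hq hv0 hv0'.le hx).1.le
  · filter_upwards [eventually_ge_atTop 0] with x hx
    exact div_le_div_of_nonneg_right (hanti hx) (hv.pos_of_le hq hv0 hv0'.le hx).1.le

lemma locallyIntegrable_comp_neg {f : ℝ → ℝ} (hf : LocallyIntegrable f volume) :
    LocallyIntegrable (fun x => f (-x)) volume := by
  have := ((isPrimitive_integral hf 0).comp_neg.const_mul (-1)).locallyIntegrable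
  simpa only [neg_one_mul, neg_neg] using this

lemma setLIntegral_Ici_comp_neg (f : ℝ → ℝ≥0∞) (x : ℝ) :
    ∫⁻ t in Ici x, f (-t) = ∫⁻ t in Iic (-x), f t := by
  have h := (Measure.measurePreserving_neg (volume : Measure ℝ)).setLIntegral_comp_preimage_emb
    (MeasurableEquiv.neg ℝ).measurableEmbedding f (Iic (-x))
  simpa using h

/-- Existence of the fundamental system of solutions. -/
lemma exists_isFSS {q : ℝ → ℝ} (hq : ∀ᵐ x : ℝ, 0 ≤ q x)
    (hq_loc : LocallyIntegrable q volume)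
    (hq_left : ∀ x : ℝ, 0 < ∫⁻ t in Iic x, ENNReal.ofReal (q t))
    (hq_right : ∀ x : ℝ, 0 < ∫⁻ t in Ici x, ENNReal.ofReal (q t)) :
    ∃ u v, IsFSS q u v := by
  obtain ⟨u, hu, hu'⟩ := exists_pos_decreasing hq hq_loc hq_right
  obtain ⟨w, hw, hw'⟩ := exists_pos_decreasing (ae_nonneg_comp_neg hq)
    (locallyIntegrable_comp_neg hq_loc) (fun x => by
      rw [setLIntegral_Ici_comp_neg (fun t => ENNReal.ofReal (q t))]; exact hq_left _)
  have hw₁ := hw.comp_neg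
  simp only [neg_neg] at hw₁
  have hw₁' : ∀ x, 0 < deriv (fun x => w (-x)) x := fun x => by
    rw [(hw.hasDerivAt_comp_neg x).deriv]; linarith [(hw' (-x)).2]
  set W := deriv (fun x => w (-x)) 0 * u 0 - deriv u 0 * w (-0) with hW
  have hWx : ∀ x, deriv (fun x => w (-x)) x * u x - deriv u x * w (-x) = W := fun x =>
    hu.wronskian_eq hw₁ x 0
  have hWpos : 0 < W := by
    have h1 := mul_pos (hw₁' 0) (hu' 0).1
    have h2 := mul_pos_of_neg_of_neg (hu' 0).2 (neg_lt_zero.2 (hw' (-0)).1)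
    rw [hW]; linarith
  -- Dividing the reflected solution by W normalizes the Wronskian to 1; the coefficient 0 leaves a
  -- pure multiple.
  have hv := hw₁.comb_zero hu W⁻¹ 0
  have hdv := fun x => hw₁.deriv_comb hu W⁻¹ 0 x
  simp only [zero_mul, add_zero] at hv hdv
  set v : ℝ → ℝ := fun x => W⁻¹ * w (-x) with hvdef
  have hvpos : ∀ x, 0 < v x := fun x => mul_pos (inv_pos.2 hWpos) (hw' _).1
  have hv'pos : ∀ x, 0 < deriv v x := fun x => by
    rw [hdv]; exact mul_pos (inv_pos.2 hWpos) (hw₁' x)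
  have hwr : ∀ x, deriv v x * u x - deriv u x * v x = 1 := fun x => by
    calc deriv v x * u x - deriv u x * v x
        = W⁻¹ * (deriv (fun x => w (-x)) x * u x - deriv u x * w (-x)) := by
          rw [hdv]; simp only [hvdef]; ring
      _ = 1 := by rw [hWx, inv_mul_cancel₀ hWpos.ne']
  refine ⟨u, v, hu, hv, fun x => (hu' x).1, hvpos, fun x => (hu' x).2, hv'pos, hwr, ?_, ?_, ?_⟩
  -- Reflection exchanges the roles of u and v, turning -∞ into +∞.
  · have h := tendsto_div_of_growth (ae_nonneg_comp_neg hq) hu.comp_neg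
      (fun x => hvpos (-x)) (fun x => by
        rw [(hv.hasDerivAt_comp_neg x).deriv]; linarith [hv'pos (-x)])
      (hu' _).1 (by rw [(hu.hasDerivAt_comp_neg _).deriv]; linarith [(hu' (-0)).2])
    have := h.comp tendsto_neg_atBot_atTop
    simpa [Function.comp_def] using this
  · exact tendsto_div_of_growth hq hv (fun x => (hu' x).1) (fun x => (hu' x).2)
      (hvpos 0) (hv'pos 0)
  · intro x
    have hd : HasDerivAt (fun s => u s * v s) _ x := (hu.hasDerivAt x).mul (hv.hasDerivAt x)
    rw [hd.deriv, abs_lt]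
    -- v'u and -u'v are positive with sum 1, so their difference (uv)' lies strictly between -1 and
    -- 1.
    have h1 := mul_pos (hv'pos x) (hu' x).1
    have h2 := mul_pos_of_neg_of_neg (hu' x).2 (neg_lt_zero.2 (hvpos x))
    constructor <;> nlinarith [hwr x]

/-! ### Linear growth is excluded from the weighted space -/

lemma memLp_inv_one_add {p' : ℝ≥0∞} (hp' : 1 < p') :
    MemLp (fun x : ℝ => (1 + |x|)⁻¹) p' volume := by
  have hm : AEStronglyMeasurable (fun x : ℝ => (1 + |x|)⁻¹) volume :=
    (Continuous.inv₀ (by fun_prop) (fun x => by positivity)).aestronglyMeasurable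
  by_cases htop : p' = ∞
  · subst htop
    refine memLp_top_of_bound hm 1 (.of_forall fun x => ?_)
    rw [Real.norm_eq_abs, abs_of_nonneg (by positivity)]
    exact inv_le_one_of_one_le₀ (by linarith [abs_nonneg x])
  · have h0 : p' ≠ 0 := (zero_lt_one.trans hp').ne'
    rw [← integrable_norm_rpow_iff hm h0 htop]
    have h1 : 1 < p'.toReal := by
      rw [← ENNReal.toReal_one]
      exact (ENNReal.toReal_lt_toReal ENNReal.one_ne_top htop).2 hp'
    refine (integrable_one_add_norm (E := ℝ) (μ := volume) (r := p'.toReal)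
      (by simpa using h1)).congr ?_
    refine .of_forall fun x => ?_
    simp only [Real.norm_eq_abs]
    rw [abs_of_nonneg (by positivity : (0:ℝ) ≤ (1 + |x|)⁻¹), Real.inv_rpow (by positivity),
      Real.rpow_neg (by positivity)]

lemma setLIntegral_Ici_eq_top {μ : ℝ → ℝ} (hμ : Continuous μ)
    (h : ∫⁻ t in Ici (0 : ℝ), ENNReal.ofReal (μ t) = ∞) (a : ℝ) :
    ∫⁻ t in Ici a, ENNReal.ofReal (μ t) = ∞ := by
  have h1 : Ici (0 : ℝ) ⊆ Icc 0 a ∪ Ici a := fun x hx => by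
    rcases le_total x a with h | h
    · exact .inl ⟨hx, h⟩
    · exact .inr h
  have h2 : ∞ ≤ (∫⁻ t in Icc 0 a, ENNReal.ofReal (μ t)) + ∫⁻ t in Ici a, ENNReal.ofReal (μ t) := by
    rw [← h]
    exact (lintegral_mono_set h1).trans (lintegral_union_le _ _ _)
  have h3 : ∫⁻ t in Icc 0 a, ENNReal.ofReal (μ t) ≠ ∞ :=
    (hμ.continuousOn.integrableOn_compact isCompact_Icc).lintegral_lt_top.ne
  exact (ENNReal.add_eq_top.1 (top_le_iff.1 h2)).resolve_left h3

/-- By Hölder's inequality, a function growing at least linearly at `+∞` is not in the weighted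
space when the weight is not integrable at `+∞`. -/
lemma eLpNorm_eq_top_of_growth {p : ℝ≥0∞} (hp : 1 ≤ p) (hp_top : p ≠ ∞) {μ y : ℝ → ℝ}
    (hμ : Continuous μ) (hμ_pos : ∀ x, 0 < μ x)
    (hμ_right : ∫⁻ t in Ici (0 : ℝ), ENNReal.ofReal (μ t) = ∞) {a c : ℝ} (ha : 0 ≤ a)
    (hc : 0 < c) (hy : ∀ x, a ≤ x → c * (1 + x) ≤ |y x|) :
    eLpNorm (fun x => μ x * y x) p volume = ∞ := by
  by_contra hne
  set p' := ENNReal.conjExponent p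
  -- p' = 1 + (p - 1)⁻¹ exceeds 1 exactly because p is finite; p = 1 gives p' = ∞.
  have hp' : 1 < p' :=
    ENNReal.lt_add_right ENNReal.one_ne_top
      (ENNReal.inv_ne_zero.2 (ENNReal.sub_ne_top hp_top))
  have : ENNReal.HolderConjugate p p' := ENNReal.HolderConjugate.conjExponent hp
  have hcont : Continuous fun x : ℝ => μ x * (1 + |x|) := by fun_prop
  have h1 : eLpNorm (fun x => μ x * (1 + |x|)) p (volume.restrict (Ici a)) < ∞ := by
    calc eLpNorm (fun x => μ x * (1 + |x|)) p (volume.restrict (Ici a))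
        ≤ ENNReal.ofReal c⁻¹ * eLpNorm (fun x => μ x * y x) p (volume.restrict (Ici a)) := by
          refine eLpNorm_le_mul_eLpNorm_of_ae_le_mul ?_ p
          rw [ae_restrict_iff' measurableSet_Ici]
          refine .of_forall fun x hx => ?_
          have hx0 : 0 ≤ x := ha.trans hx
          rw [Real.norm_eq_abs, Real.norm_eq_abs, abs_mul, abs_mul, abs_of_pos (hμ_pos x),
            abs_of_nonneg hx0, abs_of_nonneg (by linarith : 0 ≤ 1 + x)]
          have := hy x hx
          rw [mul_left_comm]
          refine mul_le_mul_of_nonneg_left ?_ (hμ_pos x).le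
          rwa [le_inv_mul_iff₀ hc]
      _ ≤ ENNReal.ofReal c⁻¹ * eLpNorm (fun x => μ x * y x) p volume := by
          exact mul_le_mul_right (eLpNorm_mono_measure _ Measure.restrict_le_self) _
      _ < ∞ := ENNReal.mul_lt_top ENNReal.ofReal_lt_top (lt_top_iff_ne_top.2 hne)
  -- Hölder for the factorization of μ into (1 + |x|)⁻¹ ∈ L_{p'} and μ(1 + |x|) ∈ L_p; it would make
  -- μ integrable on [a, ∞).
  have h2 : MemLp (fun x : ℝ => (1 + |x|)⁻¹ * (μ x * (1 + |x|))) 1 (volume.restrict (Ici a)) :=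
    MemLp.mul (p := p') (q := p) ⟨hcont.aestronglyMeasurable, h1⟩
      ((memLp_inv_one_add hp').restrict _)
  have h3 : (fun x : ℝ => (1 + |x|)⁻¹ * (μ x * (1 + |x|))) = μ := by
    ext x
    have : 1 + |x| ≠ 0 := by positivity
    field_simp
  rw [h3, memLp_one_iff_integrable] at h2
  have h4 := h2.lintegral_lt_top
  exact h4.ne (setLIntegral_Ici_eq_top hμ hμ_right a)

/-- y = (A u/v + B)v and the bracket tends to B, so B ≠ 0 gives |y| ≥ (|B|/2)v eventually. The
representation is only needed on a half-line, so the lemma also applies beyond the support of a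
right-hand side. -/
lemma coeff_eq_zero_atTop {p : ℝ≥0∞} (hp : 1 ≤ p) (hp_top : p ≠ ∞) {q μ u v y : ℝ → ℝ}
    (hq : ∀ᵐ x : ℝ, 0 ≤ q x) (hμ : Continuous μ) (hμ_pos : ∀ x, 0 < μ x)
    (hμ_right : ∫⁻ t in Ici (0 : ℝ), ENNReal.ofReal (μ t) = ∞)
    (hv : IsSolution q (fun _ => 0) v) (hv_pos : ∀ x, 0 < v x) (hv' : ∀ x, 0 < deriv v x)
    (huv : Tendsto (fun x => u x / v x) atTop (𝓝 0)) {a A B : ℝ}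
    (hy : ∀ x, a ≤ x → y x = A * u x + B * v x)
    (hy_fin : eLpNorm (fun x => μ x * y x) p volume < ∞) : B = 0 := by
  by_contra hB
  have hBpos : 0 < |B| := abs_pos.2 hB
  obtain ⟨c, hc, hcv⟩ := linear_growth hq hv (hv_pos 0) (hv' 0)
  have hlim : Tendsto (fun x => |A * (u x / v x) + B|) atTop (𝓝 |B|) := by
    simpa using ((huv.const_mul A).add_const B).abs
  obtain ⟨b, hb⟩ := (((hlim.eventually_const_le (half_lt_self hBpos)).and
    (eventually_ge_atTop a)).and (eventually_ge_atTop 0)).exists_forall_of_atTop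
  refine hy_fin.ne (eLpNorm_eq_top_of_growth hp hp_top hμ hμ_pos hμ_right
    (hb b le_rfl).2 (c := |B| / 2 * c) (by positivity) fun x hx => ?_)
  obtain ⟨⟨h1, h2⟩, h3⟩ := hb x hx
  have hyx : y x = (A * (u x / v x) + B) * v x := by
    rw [hy x h2]; field_simp [(hv_pos x).ne']
  rw [hyx, abs_mul, abs_of_pos (hv_pos x), mul_assoc]
  exact mul_le_mul h1 (hcv x h3) (by positivity) (abs_nonneg _)

lemma coeff_eq_zero_atBot {p : ℝ≥0∞} (hp : 1 ≤ p) (hp_top : p ≠ ∞) {q μ u v y : ℝ → ℝ}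
    (hq : ∀ᵐ x : ℝ, 0 ≤ q x) (hμ : Continuous μ) (hμ_pos : ∀ x, 0 < μ x)
    (hμ_left : ∫⁻ t in Iic (0 : ℝ), ENNReal.ofReal (μ t) = ∞)
    (hu : IsSolution q (fun _ => 0) u) (hu_pos : ∀ x, 0 < u x) (hu' : ∀ x, deriv u x < 0)
    (huv : Tendsto (fun x => v x / u x) atBot (𝓝 0)) {a A B : ℝ}
    (hy : ∀ x, x ≤ a → y x = A * u x + B * v x)
    (hy_fin : eLpNorm (fun x => μ x * y x) p volume < ∞) : A = 0 := by
  refine coeff_eq_zero_atTop hp hp_top (μ := fun x => μ (-x)) (y := fun x => y (-x))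
    (u := fun x => v (-x)) (a := -a) (A := B)
    (ae_nonneg_comp_neg hq) (by fun_prop) (fun x => hμ_pos _) ?_ hu.comp_neg (fun x => hu_pos _)
    (fun x => ?_) (huv.comp tendsto_neg_atTop_atBot) (fun x hx => ?_) ?_
  · rw [setLIntegral_Ici_comp_neg (fun t => ENNReal.ofReal (μ t))]; simpa using hμ_left
  · rw [(hu.hasDerivAt_comp_neg x).deriv]; linarith [hu' (-x)]
  · rw [hy (-x) (by linarith)]; ring
  · have h := (MeasurableEquiv.neg ℝ).measurableEmbedding.eLpNorm_map_measure
      (g := fun x => μ x * y x) (p := p) (μ := volume)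
    have hn : Measure.map (MeasurableEquiv.neg ℝ) (volume : Measure ℝ) = volume :=
      (Measure.measurePreserving_neg (volume : Measure ℝ)).map_eq
    rw [hn] at h
    rw [h] at hy_fin
    exact hy_fin

/-! ### The Green potential and variation of parameters -/

section Green

variable {q u v f : ℝ → ℝ}

lemma integrable_green_iff (hu : ∀ x, 0 < u x) (hv : ∀ x, 0 < v x) (x : ℝ) :
    Integrable (fun t => green u v x t * f t) ↔
      IntegrableOn (fun t => v t * f t) (Iic x) ∧ IntegrableOn (fun t => u t * f t) (Ioi x) := by
  rw [← integrableOn_univ, ← Iic_union_Ioi (a := x), integrableOn_union]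
  refine and_congr ?_ ?_
  · rw [integrableOn_congr_fun (g := fun t => u x * (v t * f t)) (fun t ht => ?_)
      measurableSet_Iic]
    · exact integrable_const_mul_iff (hu x).ne'.isUnit _
    · simp only [green, if_pos (show t ≤ x from ht)]; ring
  · rw [integrableOn_congr_fun (g := fun t => v x * (u t * f t)) (fun t ht => ?_)
      measurableSet_Ioi]
    · exact integrable_const_mul_iff (hv x).ne'.isUnit _
    · simp only [green, if_neg (not_le.2 (show x < t from ht))]; ring

lemma integral_green {x : ℝ} (h : Integrable (fun t => green u v x t * f t)) :
    ∫ t, green u v x t * f t =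
      u x * (∫ t in Iic x, v t * f t) + v x * ∫ t in Ioi x, u t * f t := by
  rw [← intervalIntegral.integral_Iic_add_Ioi h.integrableOn h.integrableOn (b := x),
    ← integral_const_mul, ← integral_const_mul]
  congr 1
  · refine setIntegral_congr_fun measurableSet_Iic fun t ht => ?_
    simp only [green, if_pos (show t ≤ x from ht)]; ring
  · refine setIntegral_congr_fun measurableSet_Ioi fun t ht => ?_
    simp only [green, if_neg (not_le.2 (show x < t from ht))]; ring

namespace IsFSS

lemma locallyIntegrable_u_mul (h : IsFSS q u v) (hf : LocallyIntegrable f volume) :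
    LocallyIntegrable (fun t => u t * f t) volume := by
  simpa only [mul_comm] using locallyIntegrable_mul_continuous hf h.sol_u.continuous

lemma locallyIntegrable_v_mul (h : IsFSS q u v) (hf : LocallyIntegrable f volume) :
    LocallyIntegrable (fun t => v t * f t) volume := by
  simpa only [mul_comm] using locallyIntegrable_mul_continuous hf h.sol_v.continuous

/-- Moving x transfers only a compact interval from one half-line to the other, and local
integrability controls it. Convergence at one point thus gives convergence at all. -/
lemma integrable_green (h : IsFSS q u v) (hf : LocallyIntegrable f volume) {x₀ : ℝ}
    (hx₀ : Integrable (fun t => green u v x₀ t * f t)) (x : ℝ) :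
    Integrable (fun t => green u v x t * f t) := by
  rw [integrable_green_iff h.pos_u h.pos_v] at hx₀ ⊢
  constructor
  · refine (hx₀.1.union ((h.locallyIntegrable_v_mul hf).integrableOn_isCompact
      (isCompact_Icc (a := x₀) (b := x)))).mono_set fun t ht => ?_
    rcases le_total t x₀ with h | h
    · exact .inl h
    · exact .inr ⟨h, ht⟩
  · refine (hx₀.2.union ((h.locallyIntegrable_u_mul hf).integrableOn_isCompact
      (isCompact_Icc (a := x) (b := x₀)))).mono_set fun t ht => ?_
    rcases lt_or_ge x₀ t with h | h
    · exact .inl h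
    · exact .inr ⟨le_of_lt ht, h⟩

/-- The Green function solves the inhomogeneous equation. -/
lemma isSolution_green (h : IsFSS q u v) (hf : LocallyIntegrable f volume)
    (hint : ∀ x, Integrable (fun t => green u v x t * f t)) :
    IsSolution q f (fun x => ∫ t, green u v x t * f t) := by
  have hV := fun x => ((integrable_green_iff h.pos_u h.pos_v x).1 (hint x)).1
  have hU := fun x => ((integrable_green_iff h.pos_u h.pos_v x).1 (hint x)).2
  set F : ℝ → ℝ := fun x => ∫ t in Iic x, v t * f t
  set H : ℝ → ℝ := fun x => ∫ t in Ioi x, u t * f t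
  have hF : IsPrimitive F (fun t => v t * f t) :=
    ⟨h.locallyIntegrable_v_mul hf, fun a b => intervalIntegral.integral_Iic_sub_Iic (hV a) (hV b)⟩
  have hH : IsPrimitive H (fun t => -1 * (u t * f t)) := by
    refine ⟨(h.locallyIntegrable_u_mul hf).smul (-1 : ℝ), fun a b => ?_⟩
    rw [intervalIntegral.integral_const_mul]
    have := intervalIntegral.integral_interval_add_Ioi (hU a) (hU b)
    simp only [H]
    linarith
  rw [show (fun x => ∫ t, green u v x t * f t) = fun x => u x * F x + v x * H x from
    funext fun x => integral_green (hint x)]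
  have hz := (h.sol_u.isPrimitive_deriv.mul hF).add (h.sol_v.isPrimitive_deriv.mul hH)
  have hy := (h.sol_u.isPrimitive.mul hF).add (h.sol_v.isPrimitive.mul hH)
  -- Variation of parameters: in y' the terms uvf and -vuf cancel, and in y'' the remainder u'vf -
  -- v'uf equals -f by the Wronskian.
  refine IsSolution.of_hasDerivAt (z := fun x => deriv u x * F x + deriv v x * H x) ?_
    (hz.congr (.of_forall fun x => ?_))
  · refine (hy.congr (.of_forall fun x => ?_)).hasDerivAt hz.continuous
    simp only
    ring
  · simp only
    linear_combination (-f x) * h.wronskian x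

/-- Every solution of the homogeneous equation is a combination of `u` and `v`. -/
lemma exists_eq_comb (h : IsFSS q u v) {y : ℝ → ℝ} (hy : IsSolution q (fun _ => 0) y) :
    ∃ A B : ℝ, ∀ x, y x = A * u x + B * v x := by
  -- Cramer's rule: the coefficients are Wronskians, so they may be evaluated at x instead of 0.
  refine ⟨deriv v 0 * y 0 - deriv y 0 * v 0, deriv y 0 * u 0 - deriv u 0 * y 0, fun x => ?_⟩
  rw [hy.wronskian_eq h.sol_v 0 x, h.sol_u.wronskian_eq hy 0 x]
  linear_combination (-y x) * h.wronskian x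

end IsFSS

end Green

/-! ### Admissibility and boundedness of S -/

lemma MemLpLoc.locallyIntegrable {p : ℝ≥0∞} (hp : 1 ≤ p) {f : ℝ → ℝ} (hf : MemLpLoc p f) :
    LocallyIntegrable f volume := by
  rw [locallyIntegrable_iff]
  intro K hK
  have : IsFiniteMeasure (volume.restrict K) := ⟨by simpa using hK.measure_lt_top⟩
  exact (hf K hK).integrable hp

/-- The local condition follows from the global one because 1/w is bounded on compact sets. -/
lemma memWeightedLp_iff {p : ℝ≥0∞} (hp : 1 ≤ p) {w f : ℝ → ℝ} (hw : Continuous w)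
    (hw_pos : ∀ x, 0 < w x) : MemWeightedLp p w f ↔ MemLp (fun x => w x * f x) p volume := by
  constructor
  · intro h
    exact ⟨hw.aestronglyMeasurable.mul (h.1.locallyIntegrable hp).aestronglyMeasurable, h.2⟩
  · intro h
    refine ⟨fun K hK => ?_, h.2⟩
    have hinv : Continuous fun x => (w x)⁻¹ := hw.inv₀ fun x => (hw_pos x).ne'
    obtain ⟨C, hC⟩ := hK.exists_bound_of_continuousOn hinv.continuousOn
    have hf : f = fun x => (w x)⁻¹ * (w x * f x) := by
      ext x
      rw [inv_mul_cancel_left₀ (hw_pos x).ne']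
    refine (h.restrict K).of_le_mul (c := C) ?_ ?_
    · rw [hf]
      exact (hinv.aestronglyMeasurable.mul h.1).restrict
    · rw [ae_restrict_iff' hK.measurableSet]
      refine .of_forall fun x hx => ?_
      rw [congrFun hf x, norm_mul]
      simp only [inv_mul_cancel_left₀ (hw_pos x).ne']
      exact mul_le_mul_of_nonneg_right (hC x hx) (norm_nonneg _)

lemma green_nonneg {u v : ℝ → ℝ} (hu : ∀ x, 0 < u x) (hv : ∀ x, 0 < v x) (x t : ℝ) :
    0 ≤ green u v x t := by
  unfold green
  split_ifs
  · exact (mul_pos (hu x) (hv t)).le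
  · exact (mul_pos (hu t) (hv x)).le

lemma measurable_green {u v : ℝ → ℝ} (hu : Continuous u) (hv : Continuous v) (x : ℝ) :
    Measurable (green u v x) :=
  Measurable.ite measurableSet_Iic (hv.measurable.const_mul _) (hu.measurable.mul_const _)

/-- At most one solution lies in the weighted space. -/
lemma IsFSS.eq_of_memWeightedLp {p : ℝ≥0∞} (hp : 1 ≤ p) (hp_top : p ≠ ∞)
    {q μ u v f y₁ y₂ : ℝ → ℝ} (hq : ∀ᵐ x : ℝ, 0 ≤ q x)
    (hμ : Continuous μ) (hμ_pos : ∀ x, 0 < μ x)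
    (hμ_left : ∫⁻ t in Iic (0 : ℝ), ENNReal.ofReal (μ t) = ∞)
    (hμ_right : ∫⁻ t in Ici (0 : ℝ), ENNReal.ofReal (μ t) = ∞) (h : IsFSS q u v)
    (h₁ : IsSolution q f y₁) (h₂ : IsSolution q f y₂)
    (hy₁ : MemWeightedLp p μ y₁) (hy₂ : MemWeightedLp p μ y₂) : y₁ = y₂ := by
  obtain ⟨A, B, hAB⟩ := h.exists_eq_comb (h₁.sub_zero h₂)
  have hfin : eLpNorm (fun x => μ x * (y₁ x - y₂ x)) p volume < ∞ := by
    have := (((memWeightedLp_iff hp hμ hμ_pos).1 hy₁).sub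
      ((memWeightedLp_iff hp hμ hμ_pos).1 hy₂)).2
    simp only [mul_sub]
    exact this
  have hB : B = 0 := coeff_eq_zero_atTop hp hp_top hq hμ hμ_pos hμ_right h.sol_v h.pos_v
    h.deriv_v_pos h.tendsto_atTop (a := 0) (fun x _ => hAB x) hfin
  have hA : A = 0 := coeff_eq_zero_atBot hp hp_top hq hμ hμ_pos hμ_left h.sol_u h.pos_u
    h.deriv_u_neg h.tendsto_atBot (a := 0) (fun x _ => hAB x) hfin
  ext x
  have := hAB x
  rw [hA, hB] at this
  linarith

/-- f ↦ θf carries L_{p,θ} to L_p isometrically, and S(θf) is μ times the Green potential of f. -/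
lemma admissible_of_boundedS {p : ℝ≥0∞} (hp : 1 ≤ p) (hp_top : p ≠ ∞)
    {q μ θ u v : ℝ → ℝ} (hq : ∀ᵐ x : ℝ, 0 ≤ q x)
    (hμ : Continuous μ) (hμ_pos : ∀ x, 0 < μ x) (hθ : Continuous θ) (hθ_pos : ∀ x, 0 < θ x)
    (hμ_left : ∫⁻ t in Iic (0 : ℝ), ENNReal.ofReal (μ t) = ∞)
    (hμ_right : ∫⁻ t in Ici (0 : ℝ), ENNReal.ofReal (μ t) = ∞) (h : IsFSS q u v)
    (hS : BoundedS p u v μ θ) : Admissible p q μ θ := by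
  obtain ⟨C, hC⟩ := hS
  have key : ∀ f, MemWeightedLp p θ f → ∃ y, IsSolution q f y ∧ MemWeightedLp p μ y ∧
      weightedNorm p μ y ≤ C * weightedNorm p θ f := by
    intro f hf
    obtain ⟨hint, hmem, hle⟩ := hC _ ((memWeightedLp_iff hp hθ hθ_pos).1 hf)
    have hcancel : ∀ x t, green u v x t / θ t * (θ t * f t) = green u v x t * f t := fun x t => by
      rw [← mul_assoc, div_mul_cancel₀ _ (hθ_pos t).ne']
    have hop : opS u v μ θ (fun x => θ x * f x) =
        fun x => μ x * ∫ t, green u v x t * f t := by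
      ext x
      simp only [opS, hcancel]
    simp only [hcancel] at hint
    rw [hop] at hmem hle
    obtain ⟨x₀, hx₀⟩ := hint.exists
    have hloc := hf.1.locallyIntegrable hp
    exact ⟨_, h.isSolution_green hloc (h.integrable_green hloc hx₀),
      (memWeightedLp_iff hp hμ hμ_pos).2 hmem, hle⟩
  have huniq : ∀ f y₁ y₂, IsSolution q f y₁ → IsSolution q f y₂ → MemWeightedLp p μ y₁ →
      MemWeightedLp p μ y₂ → y₁ = y₂ := fun f y₁ y₂ h₁ h₂ h₃ h₄ =>
    h.eq_of_memWeightedLp hp hp_top hq hμ hμ_pos hμ_left hμ_right h₁ h₂ h₃ h₄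
  -- C may be 0, while admissibility asks for a positive constant.
  refine ⟨fun f hf => ?_, C + 1, by positivity, fun f hf y hy hy' => ?_⟩
  · obtain ⟨y, hy, hy', -⟩ := key f hf
    exact ⟨y, ⟨hy, hy'⟩, fun z hz => huniq f z y hz.1 hy hz.2 hy'⟩
  · obtain ⟨z, hz, hz', hle⟩ := key f hf
    rw [huniq f y z hy hz hy' hz']
    refine hle.trans ?_
    gcongr
    simp

lemma IsFSS.integrable_green_of_support {q u v g : ℝ → ℝ} (h : IsFSS q u v)
    (hg : LocallyIntegrable g volume) {n : ℝ} (hgn : ∀ t, t ∉ Icc (-n) n → g t = 0) (x : ℝ) :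
    Integrable (fun t => green u v x t * g t) := by
  have key : ∀ k : ℝ → ℝ, LocallyIntegrable (fun t => k t * g t) volume →
      Integrable (fun t => k t * g t) := fun k hk => by
    rw [← integrableOn_iff_integrable_of_support_subset (s := Icc (-n) n)]
    · exact hk.integrableOn_isCompact isCompact_Icc
    · intro t ht
      by_contra hc
      exact ht (by simp [hgn t hc])
  rw [integrable_green_iff h.pos_u h.pos_v]
  exact ⟨(key v (h.locallyIntegrable_v_mul hg)).integrableOn,
    (key u (h.locallyIntegrable_u_mul hg)).integrableOn⟩

/-- For compactly supported right-hand sides the solution in the weighted space is the one given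
by the Green function. -/
lemma IsFSS.eq_green_of_support {p : ℝ≥0∞} (hp : 1 ≤ p) (hp_top : p ≠ ∞)
    {q μ u v g y : ℝ → ℝ} (hq : ∀ᵐ x : ℝ, 0 ≤ q x)
    (hμ : Continuous μ) (hμ_pos : ∀ x, 0 < μ x)
    (hμ_left : ∫⁻ t in Iic (0 : ℝ), ENNReal.ofReal (μ t) = ∞)
    (hμ_right : ∫⁻ t in Ici (0 : ℝ), ENNReal.ofReal (μ t) = ∞) (h : IsFSS q u v)
    (hg : LocallyIntegrable g volume) {n : ℝ} (hgn : ∀ t, t ∉ Icc (-n) n → g t = 0)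
    (hy : IsSolution q g y) (hy' : MemWeightedLp p μ y) :
    y = fun x => ∫ t, green u v x t * g t := by
  obtain ⟨A, B, hAB⟩ := h.exists_eq_comb
    (hy.sub_zero (h.isSolution_green hg (h.integrable_green_of_support hg hgn)))
  -- Beyond the support the potential is a multiple of u, so there y is a combination of u and v
  -- whose v-coefficient is still B. The left side is symmetric.
  have hright : ∀ x, n ≤ x → ∫ t, green u v x t * g t = u x * ∫ t, v t * g t := fun x hx => by
    rw [← integral_const_mul]
    refine integral_congr_ae (.of_forall fun t => ?_)
    by_cases ht : t ∈ Icc (-n) n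
    · simp only [green, if_pos (ht.2.trans hx)]; ring
    · simp [hgn t ht]
  have hleft : ∀ x, x ≤ -n → ∫ t, green u v x t * g t = v x * ∫ t, u t * g t := fun x hx => by
    rw [← integral_const_mul]
    refine integral_congr_ae (.of_forall fun t => ?_)
    by_cases ht : t ∈ Icc (-n) n
    · rcases eq_or_lt_of_le (hx.trans ht.1) with rfl | hlt
      · simp only [green, if_pos le_rfl]; ring
      · simp only [green, if_neg (not_le.2 hlt)]; ring
    · simp [hgn t ht]
  have hB : B = 0 := coeff_eq_zero_atTop hp hp_top hq hμ hμ_pos hμ_right h.sol_v h.pos_v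
    h.deriv_v_pos h.tendsto_atTop (a := n) (A := A + ∫ t, v t * g t) (fun x hx => by
      linarith [hAB x, hright x hx]) hy'.2
  have hA : A = 0 := coeff_eq_zero_atBot hp hp_top hq hμ hμ_pos hμ_left h.sol_u h.pos_u
    h.deriv_u_neg h.tendsto_atBot (a := -n) (B := B + ∫ t, u t * g t) (fun x hx => by
      linarith [hAB x, hleft x hx]) hy'.2
  ext x
  have := hAB x
  rw [hA, hB] at this
  linarith

/-- Weighted estimate for the Green potential of `|f| / θ`, obtained from compactly supported
truncations by monotone convergence. -/
lemma lintegral_green_rpow_le {p : ℝ≥0∞} (hp : 1 ≤ p) (hp_top : p ≠ ∞)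
    {q μ θ u v f : ℝ → ℝ} (hq : ∀ᵐ x : ℝ, 0 ≤ q x)
    (hμ : Continuous μ) (hμ_pos : ∀ x, 0 < μ x) (hθ : Continuous θ) (hθ_pos : ∀ x, 0 < θ x)
    (hμ_left : ∫⁻ t in Iic (0 : ℝ), ENNReal.ofReal (μ t) = ∞)
    (hμ_right : ∫⁻ t in Ici (0 : ℝ), ENNReal.ofReal (μ t) = ∞) (h : IsFSS q u v)
    (hadm : ∀ f : ℝ → ℝ, MemWeightedLp p θ f →
      ∃! y : ℝ → ℝ, IsSolution q f y ∧ MemWeightedLp p μ y) {c : ℝ≥0}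
    (hc : ∀ f : ℝ → ℝ, MemWeightedLp p θ f → ∀ y : ℝ → ℝ, IsSolution q f y →
      MemWeightedLp p μ y → weightedNorm p μ y ≤ c * weightedNorm p θ f)
    (hf : MemLp f p volume) :
    ∫⁻ x, (ENNReal.ofReal (μ x) * ∫⁻ t, ENNReal.ofReal (green u v x t * (|f t| / θ t)))
      ^ p.toReal ≤ (c * eLpNorm f p volume) ^ p.toReal := by
  have hp0 : p ≠ 0 := (zero_lt_one.trans_le hp).ne'
  have hpr : 0 < p.toReal := ENNReal.toReal_pos hp0 hp_top
  -- Using |f| makes the truncations nonnegative and increasing in n, so the inner integrals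
  -- converge monotonically.
  set g : ℕ → ℝ → ℝ := fun n => (Icc (-n : ℝ) n).indicator fun t => |f t| / θ t with hgdef
  have hg_nonneg : ∀ n t, 0 ≤ g n t := fun n t =>
    indicator_nonneg (fun t _ => div_nonneg (abs_nonneg _) (hθ_pos t).le) t
  have hgn : ∀ (n : ℕ) t, t ∉ Icc (-n : ℝ) n → g n t = 0 := fun n t ht => indicator_of_notMem ht _
  have hgθ : ∀ n, (fun x => θ x * g n x) = (Icc (-n : ℝ) n).indicator fun t => |f t| := by
    intro n
    ext x
    by_cases hx : x ∈ Icc (-n : ℝ) n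
    · simp only [hgdef, indicator_of_mem hx]
      rw [mul_div_cancel₀ _ (hθ_pos x).ne']
    · simp only [hgdef, indicator_of_notMem hx, mul_zero]
  have hg_mem : ∀ n, MemWeightedLp p θ (g n) := fun n => by
    rw [memWeightedLp_iff hp hθ hθ_pos, hgθ]
    exact hf.abs.indicator measurableSet_Icc
  have hg_norm : ∀ n, weightedNorm p θ (g n) ≤ eLpNorm f p volume := fun n => by
    rw [weightedNorm, hgθ]
    refine (eLpNorm_indicator_le _).trans_eq ?_
    exact eLpNorm_norm f
  have hg_loc : ∀ n, LocallyIntegrable (g n) volume := fun n =>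
    (hg_mem n).1.locallyIntegrable hp
  have hint : ∀ n x, Integrable (fun t => green u v x t * g n t) := fun n =>
    h.integrable_green_of_support (hg_loc n) (hgn n)
  have hy : ∀ n, weightedNorm p μ (fun x => ∫ t, green u v x t * g n t) ≤
      c * eLpNorm f p volume := fun n => by
    obtain ⟨y, ⟨hy, hy'⟩, -⟩ := hadm _ (hg_mem n)
    rw [← h.eq_green_of_support hp hp_top hq hμ hμ_pos hμ_left hμ_right (hg_loc n) (hgn n) hy hy']
    refine (hc _ (hg_mem n) y hy hy').trans ?_
    gcongr
    exact hg_norm n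
  have hycont : ∀ n, Continuous fun x => ∫ t, green u v x t * g n t := fun n =>
    (h.isSolution_green (hg_loc n) (hint n)).continuous
  set k : ℕ → ℝ → ℝ≥0∞ := fun n x => ‖μ x * ∫ t, green u v x t * g n t‖ₑ with hkdef
  have hk_meas : ∀ n, Measurable (k n) := fun n => (hμ.mul (hycont n)).measurable.enorm
  have hk_int : ∀ n, ∫⁻ x, k n x ^ p.toReal ≤ (c * eLpNorm f p volume) ^ p.toReal := fun n => by
    have := hy n
    rw [weightedNorm, eLpNorm_eq_lintegral_rpow_enorm_toReal hp0 hp_top, one_div,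
      ENNReal.rpow_inv_le_iff hpr] at this
    exact this
  have hk_eq : ∀ n x, k n x =
      ENNReal.ofReal (μ x) * ∫⁻ t, ENNReal.ofReal (green u v x t * g n t) := fun n x => by
    have hnn : ∀ t, 0 ≤ green u v x t * g n t := fun t =>
      mul_nonneg (green_nonneg h.pos_u h.pos_v x t) (hg_nonneg n t)
    rw [← ofReal_integral_eq_lintegral_ofReal (hint n x) (.of_forall hnn),
      ← ENNReal.ofReal_mul (hμ_pos x).le, hkdef]
    exact Real.enorm_of_nonneg (mul_nonneg (hμ_pos x).le (integral_nonneg hnn))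
  have hk_lim : ∀ x, Tendsto (fun n => k n x) atTop (𝓝 (ENNReal.ofReal (μ x) *
      ∫⁻ t, ENNReal.ofReal (green u v x t * (|f t| / θ t)))) := fun x => by
    simp only [hk_eq]
    refine ENNReal.Tendsto.const_mul ?_ (.inr ENNReal.ofReal_ne_top)
    refine lintegral_tendsto_of_tendsto_of_monotone
      (fun n => (hint n x).1.aemeasurable.ennreal_ofReal) (.of_forall fun t => ?_)
      (.of_forall fun t => ?_)
    · intro m n hmn
      refine ENNReal.ofReal_le_ofReal (mul_le_mul_of_nonneg_left ?_
        (green_nonneg h.pos_u h.pos_v x t))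
      have hmn' : (m : ℝ) ≤ n := Nat.cast_le.2 hmn
      exact indicator_le_indicator_of_subset (Icc_subset_Icc (by linarith) hmn')
        (fun t => div_nonneg (abs_nonneg _) (hθ_pos t).le) t
    · refine tendsto_const_nhds.congr' ?_
      obtain ⟨N, hN⟩ := exists_nat_ge |t|
      filter_upwards [eventually_ge_atTop N] with n hn
      have hn' : (N : ℝ) ≤ n := Nat.cast_le.2 hn
      simp only [hgdef]
      rw [indicator_of_mem (show t ∈ Icc (-n : ℝ) n from abs_le.1 (hN.trans hn'))]
  -- For the outer integral the pointwise limit and Fatou's lemma suffice.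
  calc _ = ∫⁻ x, liminf (fun n => k n x ^ p.toReal) atTop := by
        refine lintegral_congr fun x => ?_
        exact (((ENNReal.continuous_rpow_const).tendsto _).comp (hk_lim x)).liminf_eq.symm
    _ ≤ liminf (fun n => ∫⁻ x, k n x ^ p.toReal) atTop :=
        lintegral_liminf_le fun n => (hk_meas n).pow_const _
    _ ≤ (c * eLpNorm f p volume) ^ p.toReal :=
        liminf_le_of_le (by isBoundedDefault) fun b hb => by
          obtain ⟨n, hn⟩ := hb.exists
          exact hn.trans (hk_int n)

/-- The admissibility constant itself bounds S, since |Sf| is at most μ times the potential of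
|f|/θ. -/
lemma boundedS_of_admissible {p : ℝ≥0∞} (hp : 1 ≤ p) (hp_top : p ≠ ∞)
    {q μ θ u v : ℝ → ℝ} (hq : ∀ᵐ x : ℝ, 0 ≤ q x)
    (hμ : Continuous μ) (hμ_pos : ∀ x, 0 < μ x) (hθ : Continuous θ) (hθ_pos : ∀ x, 0 < θ x)
    (hμ_left : ∫⁻ t in Iic (0 : ℝ), ENNReal.ofReal (μ t) = ∞)
    (hμ_right : ∫⁻ t in Ici (0 : ℝ), ENNReal.ofReal (μ t) = ∞) (h : IsFSS q u v)
    (hadm : Admissible p q μ θ) : BoundedS p u v μ θ := by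
  obtain ⟨hex, c, -, hc⟩ := hadm
  have hp0 : p ≠ 0 := (zero_lt_one.trans_le hp).ne'
  have hpr : 0 < p.toReal := ENNReal.toReal_pos hp0 hp_top
  refine ⟨c, fun f hf => ?_⟩
  have hle := lintegral_green_rpow_le hp hp_top hq hμ hμ_pos hθ hθ_pos hμ_left hμ_right h hex hc hf
  set T : ℝ → ℝ≥0∞ := fun x => ∫⁻ t, ENNReal.ofReal (green u v x t * (|f t| / θ t))
  change ∫⁻ x, (ENNReal.ofReal (μ x) * T x) ^ p.toReal ≤ _ at hle
  have hfin : ∫⁻ x, (ENNReal.ofReal (μ x) * T x) ^ p.toReal ≠ ∞ :=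
    (hle.trans_lt (ENNReal.rpow_lt_top_of_nonneg hpr.le
      (ENNReal.mul_lt_top ENNReal.coe_lt_top hf.2).ne)).ne
  -- Were `T` infinite everywhere, μ > 0 would make the outer integral infinite. One finite value is
  -- enough for absolute convergence at every x.
  obtain ⟨x₀, hx₀⟩ : ∃ x, T x ≠ ∞ := by
    by_contra! hcon
    apply hfin
    have : ∀ x, (ENNReal.ofReal (μ x) * T x) ^ p.toReal = ∞ := fun x => by
      rw [hcon x, ENNReal.mul_top (by simpa using hμ_pos x), ENNReal.top_rpow_of_pos hpr]
    simp [this]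
  have hfθ : MemWeightedLp p θ (fun t => f t / θ t) := by
    rw [memWeightedLp_iff hp hθ hθ_pos]
    simpa only [mul_div_cancel₀ _ (hθ_pos _).ne'] using hf
  have hloc := hfθ.1.locallyIntegrable hp
  have hnorm : ∀ x t, ‖green u v x t * (f t / θ t)‖ = green u v x t * (|f t| / θ t) := fun x t => by
    rw [Real.norm_eq_abs, abs_mul, abs_div, abs_of_nonneg (green_nonneg h.pos_u h.pos_v x t),
      abs_of_pos (hθ_pos t)]
  have henorm : ∀ x, ∫⁻ t, ‖green u v x t * (f t / θ t)‖ₑ = T x := fun x => by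
    refine lintegral_congr fun t => ?_
    rw [← ofReal_norm, hnorm]
  have hint₀ : Integrable (fun t => green u v x₀ t * (f t / θ t)) := by
    refine ⟨(measurable_green h.sol_u.continuous h.sol_v.continuous x₀).aestronglyMeasurable.mul
      hloc.aestronglyMeasurable, ?_⟩
    rw [HasFiniteIntegral, henorm]
    exact lt_top_iff_ne_top.2 hx₀
  have hint := h.integrable_green hloc hint₀
  have hswap : ∀ x t, green u v x t / θ t * f t = green u v x t * (f t / θ t) := fun x t => by
    ring
  have hop : opS u v μ θ f = fun x => μ x * ∫ t, green u v x t * (f t / θ t) := by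
    ext x
    simp only [opS, hswap]
  -- Measurability of Sf comes from continuity: the potential is a solution of the equation.
  have hcont : Continuous (opS u v μ θ f) := by
    rw [hop]
    exact hμ.mul (h.isSolution_green hloc hint).continuous
  have hbound : eLpNorm (opS u v μ θ f) p volume ≤ c * eLpNorm f p volume := by
    rw [eLpNorm_eq_lintegral_rpow_enorm_toReal hp0 hp_top, one_div, ENNReal.rpow_inv_le_iff hpr]
    refine (lintegral_mono fun x => ?_).trans hle
    refine ENNReal.rpow_le_rpow ?_ hpr.le
    rw [hop, enorm_mul, Real.enorm_of_nonneg (hμ_pos x).le, ← henorm]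
    gcongr
    exact enorm_integral_le_lintegral_enorm _
  refine ⟨.of_forall fun x => ?_, ⟨hcont.aestronglyMeasurable, ?_⟩, hbound⟩
  · simp only [hswap]
    exact hint x
  · exact hbound.trans_lt (ENNReal.mul_lt_top ENNReal.coe_lt_top hf.2)

end SturmLiouville

end

theorem theorem4p3 (p : ℝ≥0∞) (hp : 1 ≤ p) (hp_top : p ≠ ∞)
    (q μ θ : ℝ → ℝ)
    (hq_nonneg : ∀ᵐ x : ℝ, 0 ≤ q x) (hq_loc : LocallyIntegrable q volume)
    (hq_left : ∀ x : ℝ, 0 < ∫⁻ t in Iic x, ENNReal.ofReal (q t))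
    (hq_right : ∀ x : ℝ, 0 < ∫⁻ t in Ici x, ENNReal.ofReal (q t))
    (hμ_cont : Continuous μ) (hμ_pos : ∀ x, 0 < μ x)
    (hθ_cont : Continuous θ) (hθ_pos : ∀ x, 0 < θ x)
    (hμ_left : ∫⁻ t in Iic (0 : ℝ), ENNReal.ofReal (μ t) = ∞)
    (hμ_right : ∫⁻ t in Ici (0 : ℝ), ENNReal.ofReal (μ t) = ∞) :
    (∃ u v : ℝ → ℝ, SturmLiouville.IsFSS q u v) ∧
    ∀ u v : ℝ → ℝ, SturmLiouville.IsFSS q u v →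
      (SturmLiouville.Admissible p q μ θ ↔ SturmLiouville.BoundedS p u v μ θ) := by
  refine ⟨SturmLiouville.exists_isFSS hq_nonneg hq_loc hq_left hq_right, fun u v h => ⟨?_, ?_⟩⟩
  · exact SturmLiouville.boundedS_of_admissible hp hp_top hq_nonneg hμ_cont hμ_pos hθ_cont hθ_pos
      hμ_left hμ_right h
  · exact SturmLiouville.admissible_of_boundedS hp hp_top hq_nonneg hμ_cont hμ_pos hθ_cont hθ_pos
      hμ_left hμ_right h
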